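/- Let $(E,\mathcal E)$ be a measurable space such that $\mathcal E$ is countably generated and the diagonal $\{(x,x):x\in E\}$ belongs to $\mathcal E\otimes\mathcal E$. Let $P$ be a Markov kernel on $E$ with $n$-step transition probabilities $P_n(x,\cdot)$, let $\mathbb P_x$ be the law on $(E^{\mathbb N_0},\mathcal E^{\otimes\mathbb N_0})$ of the Markov chain with kernel $P$ started at $x$, and let $\mu$ be an invariant probability measure of $P$. Write $d(\nu_1,\nu_2)=\sup_{A\in\mathcal E}|\nu_1(A)-\nu_2(A)|$ and $\mathbb N=\{1,2,\dots\}$. Call $x,y\in E$ *asymptotically equivalent* if for every $\varepsilon>0$ there are $n\in\mathbb N$ and $A\in\mathcal E$ such that $P_n(x,A)\ge 1-\varepsilon$, $P_n(y,A)\ge 1-\varepsilon$, and the restrictions of $P_n(x,\cdot)$ and $P_n(y,\cdot)$ to $A$ are mutually absolutely continuous. A *coupling* of $\mathbb P_x$ and $\mathbb P_y$ is a pair of $E$-valued sequences $(X_k)_{k\in\mathbb N_0},(Y_k)_{k\in\mathbb N_0}$ of random variables on a common probability space $(\Omega,\mathcal F,\mathbb P)$ with laws $\mathbb P_x$ and $\mathbb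 P_y$; call it *successful* if $\lim_{n\to\infty}\mathbb P(X_k=Y_k\text{ for all }k\ge n)=1$. Consider the following conditions. - $\mathrm A_1$: all $x,y\in E$ are asymptotically equivalent. - $\mathrm A_2$: for all $x,y\in E$ there is $n\in\mathbb N$ such that $P_n(x,\cdot)$ and $P_n(y,\cdot)$ are not mutually singular. - $\mathrm A_3$: for $\mu\otimes\mu$-almost all $(x,y)$ there is $n\in\mathbb N$ such that $P_n(x,\cdot)$ and $P_n(y,\cdot)$ are not mutually singular. - $\mathrm P_3$: $\lim_{n\to\infty}d(P_n(x,\cdot),\mu)=0$ for $\mu$-almost all $x\in E$. - $\mathrm C_1'$: for all $x,y\in E$ there is a successful coupling of $\mathbb P_x$ and $\mathbb P_y$. - $\mathrm C_2'$: for all $x,y\in E$ there is a coupling of $\mathbb P_x$ and $\mathbb P_y$ with $\liminf_{n\to\infty}\mathbb P(X_k=Y_k\text{ for all }k\ge n)>0$, and for $\mu\otimes\mu$-almost all $(x,y)$ there is a successful coupling of $\mathbb P_x$ and $\mathbb P_y$. - $\mathrm C_3'$: for $\mu\otimes\mu$-almost all $(x,y)$ there is a successful coupling of $\mathbb P_x$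 and $\mathbb P_y$. Then $\mathrm A_3\Rightarrow\mathrm P_3$. If, moreover, $(E,\mathcal E)$ is a Borel space, i.e. isomorphic as a measurable space to a Borel subset of $[0,1]$, then $\mathrm A_1\Rightarrow\mathrm C_1'$, $\mathrm A_2\Rightarrow\mathrm C_2'$ and $\mathrm A_3\Rightarrow\mathrm C_3'$. -/

import Mathlib

open MeasureTheory ProbabilityTheory Filter
open scoped Topology

universe u

namespace TVConvergence

noncomputable section

/-- Total variation distance `sup_A |ν₁(A) - ν₂(A)|`, the supremum over all measurable sets. -/
def tvDist {S : Type*} [MeasurableSpace S] (ν₁ ν₂ : Measure S) : ℝ :=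
  ⨆ A : {A : Set S // MeasurableSet A}, |ν₁.real A - ν₂.real A|

/-- `ξ` is a coupling of `ν₁` and `ν₂`: its marginals are `ν₁` and `ν₂`. -/
def IsCoupling {S : Type*} [MeasurableSpace S] (ν₁ ν₂ : Measure S) (ξ : Measure (S × S)) : Prop :=
  ξ.fst = ν₁ ∧ ξ.snd = ν₂

/-- The law on `E^ℕ` of the Markov chain with transition kernel `P` started at `x`: the next state
is drawn from `P` evaluated at the current state, the last coordinate of the history. -/
def chainLaw {E : Type*} [MeasurableSpace E] (P : Kernel E E) [IsMarkovKernel P] (x : E) :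
    Measure (ℕ → E) :=
  Kernel.trajMeasure (X := fun _ : ℕ => E) (Measure.dirac x)
    (fun n => P.comap (fun h : (i : Finset.Iic n) → E => h ⟨n, Finset.mem_Iic.2 le_rfl⟩)
      (measurable_pi_apply _))

/-- The random sequences `X`, `Y` on the probability space `(Ω, ρ)` form a coupling of the laws of
the chains started at `x` and at `y`. -/
def IsChainCoupling {E : Type*} [MeasurableSpace E] (P : Kernel E E) [IsMarkovKernel P] (x y : E)
    {Ω : Type*} [MeasurableSpace Ω] (ρ : Measure Ω) (X Y : Ω → ℕ → E) : Prop :=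
  IsProbabilityMeasure ρ ∧ Measurable X ∧ Measurable Y ∧
    IsCoupling (chainLaw P x) (chainLaw P y) (ρ.map fun ω => (X ω, Y ω))

/-- There is a coupling of the chains started at `x` and `y` with
`lim_n ρ(X_k = Y_k for all k ≥ n) = 1`. -/
def HasSuccessfulCoupling {E : Type u} [MeasurableSpace E] (P : Kernel E E) [IsMarkovKernel P]
    (x y : E) : Prop :=
  ∃ (Ω : Type u) (_ : MeasurableSpace Ω) (ρ : Measure Ω) (X Y : Ω → ℕ → E),
    IsChainCoupling P x y ρ X Y ∧
      Tendsto (fun n : ℕ => ρ {ω | ∀ k ≥ n, X ω k = Y ω k}) atTop (𝓝 1)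

/-- There is a coupling of the chains started at `x` and `y` with
`liminf_n ρ(X_k = Y_k for all k ≥ n) > 0`. -/
def HasPartialCoupling {E : Type u} [MeasurableSpace E] (P : Kernel E E) [IsMarkovKernel P]
    (x y : E) : Prop :=
  ∃ (Ω : Type u) (_ : MeasurableSpace Ω) (ρ : Measure Ω) (X Y : Ω → ℕ → E),
    IsChainCoupling P x y ρ X Y ∧
      0 < liminf (fun n : ℕ => ρ {ω | ∀ k ≥ n, X ω k = Y ω k}) atTop

/-- Asymptotic equivalence of the states `x` and `y`; `P ^ n` is the `n`-step kernel. -/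
def AsympEquiv {E : Type*} [MeasurableSpace E] (P : Kernel E E) (x y : E) : Prop :=
  ∀ ε : ℝ, 0 < ε → ∃ n : ℕ, 1 ≤ n ∧ ∃ A : Set E, MeasurableSet A ∧
    1 - ε ≤ ((P ^ n) x).real A ∧ 1 - ε ≤ ((P ^ n) y).real A ∧
    ((P ^ n) x).restrict A ≪ ((P ^ n) y).restrict A ∧
    ((P ^ n) y).restrict A ≪ ((P ^ n) x).restrict A

/-- Some `n`-step transition probabilities from `x` and `y`, `n ≥ 1`, are non-singular. -/
def EventuallyNonsingular {E : Type*} [MeasurableSpace E] (P : Kernel E E) (x y : E) : Prop :=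
  ∃ n : ℕ, 1 ≤ n ∧ ¬ ((P ^ n) x ⟂ₘ (P ^ n) y)

def AssumptionA1 {E : Type*} [MeasurableSpace E] (P : Kernel E E) : Prop :=
  ∀ x y : E, AsympEquiv P x y

def AssumptionA2 {E : Type*} [MeasurableSpace E] (P : Kernel E E) : Prop :=
  ∀ x y : E, EventuallyNonsingular P x y

def AssumptionA3 {E : Type*} [MeasurableSpace E] (P : Kernel E E) (μ : Measure E) : Prop :=
  ∀ᵐ z ∂(μ.prod μ), EventuallyNonsingular P z.1 z.2

def PropertyP3 {E : Type*} [MeasurableSpace E] (P : Kernel E E) (μ : Measure E) : Prop :=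
  ∀ᵐ x ∂μ, Tendsto (fun n : ℕ => tvDist ((P ^ n) x) μ) atTop (𝓝 0)

def AssumptionC1' {E : Type u} [MeasurableSpace E] (P : Kernel E E) [IsMarkovKernel P] : Prop :=
  ∀ x y : E, HasSuccessfulCoupling P x y

def AssumptionC2' {E : Type u} [MeasurableSpace E] (P : Kernel E E) [IsMarkovKernel P]
    (μ : Measure E) : Prop :=
  (∀ x y : E, HasPartialCoupling P x y) ∧
    ∀ᵐ z ∂(μ.prod μ), HasSuccessfulCoupling P z.1 z.2

def AssumptionC3' {E : Type u} [MeasurableSpace E] (P : Kernel E E) [IsMarkovKernel P]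
    (μ : Measure E) : Prop :=
  ∀ᵐ z ∂(μ.prod μ), HasSuccessfulCoupling P z.1 z.2

end

end TVConvergence

/-! Let L(x, y) = `limitDist P (x, y)` be the limit of d(P_n x, P_n y), which decreases in n.
Conditioning on a pair of states at time n, together with convexity of total variation, bounds L(x,
y) by the mean of L under any coupling of P_n x and P_n y (`limitDist_le_integral`). For the
independent coupling this says that L is subharmonic for two independent copies of the chain, which
leave μ ⊗ μ invariant; a bounded subharmonic function of a stationary chain does not change along
its steps (`ae_ae_eq_of_le_integral`). Now couple P_n x and P_n y by placing their common part on
the diagonal, where L vanishes, and the rest as a normalised product. The result is L(x, y) ≤ q L(x,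
y), where q, the mass of the rest, is below 1 if the two laws are non-singular; hence L(x, y) = 0
(`limitDist_eq_zero_of_not_mutuallySingular`). Averaging over y with law μ gives P₃, and asymptotic
equivalence carries the convergence to every x (`tendsto_tvDist_of_assumptionA1`).

A single coupling of the path laws serves all times at once (`exists_isCoupling_forall_le_tvDist`):
the common parts of the laws of the path after time n are matched for one n after the other, and the
mass still unmatched after stage n is at most d(P_n x, P_n y). Matched pieces are glued by regular
conditional laws, which is where the Borel hypothesis enters. A successful coupling then only needs
L(x, y) = 0, and a partial one only d(P_n x, P_n y) < 1 for some n. -/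

namespace TVConvergence

/-! ### Total variation distance: common parts, contraction, measurability. -/

section TotalVariation

variable {S : Type*} [MeasurableSpace S]

lemma abs_real_sub_real_le_tvDist (ν₁ ν₂ : Measure S) [IsFiniteMeasure ν₁] [IsFiniteMeasure ν₂]
    {A : Set S} (hA : MeasurableSet A) : |ν₁.real A - ν₂.real A| ≤ tvDist ν₁ ν₂ := by
  have hb : BddAbove (Set.range fun A : {A : Set S // MeasurableSet A} =>
      |ν₁.real A - ν₂.real A|) := by
    refine ⟨ν₁.real Set.univ + ν₂.real Set.univ, ?_⟩
    rintro _ ⟨B, rfl⟩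
    have h₁ : ν₁.real B ≤ ν₁.real Set.univ := measureReal_mono (Set.subset_univ _)
    have h₂ : ν₂.real B ≤ ν₂.real Set.univ := measureReal_mono (Set.subset_univ _)
    have h₃ : 0 ≤ ν₁.real B := measureReal_nonneg
    have h₄ : 0 ≤ ν₂.real B := measureReal_nonneg
    exact abs_le.2 ⟨by linarith, by linarith⟩
  exact le_ciSup hb (⟨A, hA⟩ : {A : Set S // MeasurableSet A})

instance nonempty_measurableSets : Nonempty {A : Set S // MeasurableSet A} :=
  ⟨⟨∅, MeasurableSet.empty⟩⟩

lemma tvDist_le {ν₁ ν₂ : Measure S} {c : ℝ}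
    (h : ∀ A, MeasurableSet A → |ν₁.real A - ν₂.real A| ≤ c) : tvDist ν₁ ν₂ ≤ c :=
  ciSup_le fun A => h A A.2

lemma tvDist_nonneg (ν₁ ν₂ : Measure S) : 0 ≤ tvDist ν₁ ν₂ :=
  Real.iSup_nonneg fun _ => abs_nonneg _

lemma tvDist_le_one (ν₁ ν₂ : Measure S) [IsProbabilityMeasure ν₁] [IsProbabilityMeasure ν₂] :
    tvDist ν₁ ν₂ ≤ 1 := by
  refine tvDist_le fun A _ => ?_
  have h₁ : ν₁.real A ≤ 1 := measureReal_le_one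
  have h₂ : ν₂.real A ≤ 1 := measureReal_le_one
  have h₃ : 0 ≤ ν₁.real A := measureReal_nonneg
  have h₄ : 0 ≤ ν₂.real A := measureReal_nonneg
  exact abs_le.2 ⟨by linarith, by linarith⟩

@[simp]
lemma tvDist_self (ν : Measure S) : tvDist ν ν = 0 :=
  le_antisymm (tvDist_le fun A _ => by simp) (tvDist_nonneg _ _)

lemma tvDist_comm (ν₁ ν₂ : Measure S) : tvDist ν₁ ν₂ = tvDist ν₂ ν₁ := by
  simp only [tvDist, abs_sub_comm]

lemma tvDist_triangle (ν₁ ν₂ ν₃ : Measure S) [IsFiniteMeasure ν₁] [IsFiniteMeasure ν₂]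
    [IsFiniteMeasure ν₃] : tvDist ν₁ ν₃ ≤ tvDist ν₁ ν₂ + tvDist ν₂ ν₃ :=
  tvDist_le fun _ hA => (abs_sub_le _ _ _).trans
    (add_le_add (abs_real_sub_real_le_tvDist _ _ hA) (abs_real_sub_real_le_tvDist _ _ hA))

/-- Two finite measures split into a common part and mutually singular remainders. -/
lemma exists_common_add_mutuallySingular (ν₁ ν₂ : Measure S) [IsFiniteMeasure ν₁]
    [IsFiniteMeasure ν₂] :
    ∃ m a b : Measure S, ν₁ = m + a ∧ ν₂ = m + b ∧ a ⟂ₘ b := by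
  obtain ⟨s, hs, h₁, h₂⟩ := hahn_decomposition ν₁ ν₂
  have le₁ : ν₂.restrict s ≤ ν₁.restrict s := Measure.le_iff.2 fun t ht => by
    rw [Measure.restrict_apply ht, Measure.restrict_apply ht]
    exact h₁ _ (ht.inter hs) Set.inter_subset_right
  have le₂ : ν₁.restrict sᶜ ≤ ν₂.restrict sᶜ := Measure.le_iff.2 fun t ht => by
    rw [Measure.restrict_apply ht, Measure.restrict_apply ht]
    exact h₂ _ (ht.inter hs.compl) Set.inter_subset_right
  -- The common part is the minimum of the two measures: `ν₂` is the smaller on `s`, `ν₁` off `s`.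
  refine ⟨ν₂.restrict s + ν₁.restrict sᶜ, ν₁.restrict s - ν₂.restrict s,
    ν₂.restrict sᶜ - ν₁.restrict sᶜ, ?_, ?_, ?_⟩
  · conv_lhs => rw [← Measure.restrict_add_restrict_compl (μ := ν₁) hs]
    rw [add_right_comm, add_comm (ν₂.restrict s), Measure.sub_add_cancel_of_le le₁]
  · conv_lhs => rw [← Measure.restrict_add_restrict_compl (μ := ν₂) hs]
    rw [add_assoc, add_comm (ν₁.restrict sᶜ), Measure.sub_add_cancel_of_le le₂]
  · refine ⟨sᶜ, hs.compl, ?_, ?_⟩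
    · refine le_antisymm ((Measure.sub_le _).trans ?_) zero_le
      simp [Measure.restrict_apply hs.compl]
    · refine le_antisymm ((Measure.sub_le _).trans ?_) zero_le
      simp [Measure.restrict_apply hs]

lemma isFiniteMeasure_left_of_eq_add {ν a b : Measure S} [IsFiniteMeasure ν] (h : ν = a + b) :
    IsFiniteMeasure a :=
  isFiniteMeasure_of_le ν (h ▸ Measure.le_add_right le_rfl)

lemma isFiniteMeasure_right_of_eq_add {ν a b : Measure S} [IsFiniteMeasure ν] (h : ν = a + b) :
    IsFiniteMeasure b :=
  isFiniteMeasure_of_le ν (h ▸ Measure.le_add_left le_rfl)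

/-- A set carrying `a` and null for `b` is a test set for the supremum. With `tvDist_add_left_le`,
distance is identified with the mass of the singular remainders. -/
lemma real_univ_le_tvDist {m a b : Measure S} [IsFiniteMeasure m] [IsFiniteMeasure a]
    [IsFiniteMeasure b] (hab : a ⟂ₘ b) : a.real Set.univ ≤ tvDist (m + a) (m + b) := by
  obtain ⟨s, hs, ha, hb⟩ := hab
  refine le_trans ?_ (abs_real_sub_real_le_tvDist _ _ hs.compl)
  rw [measureReal_add_apply, measureReal_add_apply]
  have h₁ : a.real s = 0 := by simp [Measure.real, ha]
  have h₂ : b.real sᶜ = 0 := by simp [Measure.real, hb]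
  have h₃ := measureReal_add_measureReal_compl (μ := a) hs
  refine le_trans (le_of_eq ?_) (le_abs_self _)
  linarith

lemma tvDist_add_left_le (m a b : Measure S) [IsFiniteMeasure m] [IsFiniteMeasure a]
    [IsFiniteMeasure b] :
    tvDist (m + a) (m + b) ≤ max (a.real Set.univ) (b.real Set.univ) := by
  refine tvDist_le fun A hA => ?_
  rw [measureReal_add_apply, measureReal_add_apply, add_sub_add_left_eq_sub]
  have h₁ : a.real A ≤ a.real Set.univ := measureReal_mono (Set.subset_univ _)
  have h₂ : b.real A ≤ b.real Set.univ := measureReal_mono (Set.subset_univ _)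
  have h₃ : 0 ≤ a.real A := measureReal_nonneg
  have h₄ : 0 ≤ b.real A := measureReal_nonneg
  have h₅ := le_max_left (a.real Set.univ) (b.real Set.univ)
  have h₆ := le_max_right (a.real Set.univ) (b.real Set.univ)
  exact abs_le.2 ⟨by linarith, by linarith⟩

lemma real_univ_comp {T : Type*} [MeasurableSpace T] (κ : Kernel S T) [IsMarkovKernel κ]
    (ν : Measure S) : (κ ∘ₘ ν).real Set.univ = ν.real Set.univ := by
  simp [Measure.real, Measure.bind_apply MeasurableSet.univ κ.aemeasurable]

/-- A Markov kernel contracts the total variation distance. -/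
lemma tvDist_comp_le {T : Type*} [MeasurableSpace T] (κ : Kernel S T) [IsMarkovKernel κ]
    (ν₁ ν₂ : Measure S) [IsFiniteMeasure ν₁] [IsFiniteMeasure ν₂] :
    tvDist (κ ∘ₘ ν₁) (κ ∘ₘ ν₂) ≤ tvDist ν₁ ν₂ := by
  obtain ⟨m, a, b, h₁, h₂, hab⟩ := exists_common_add_mutuallySingular ν₁ ν₂
  have := isFiniteMeasure_left_of_eq_add h₁
  have := isFiniteMeasure_right_of_eq_add h₁
  have := isFiniteMeasure_right_of_eq_add h₂
  rw [h₁, h₂, Measure.comp_add, Measure.comp_add]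
  refine (tvDist_add_left_le _ _ _).trans ?_
  rw [real_univ_comp, real_univ_comp]
  refine max_le (real_univ_le_tvDist hab) ?_
  rw [tvDist_comm]
  exact real_univ_le_tvDist hab.symm

lemma tvDist_map_le {T : Type*} [MeasurableSpace T] {φ : S → T} (hφ : Measurable φ)
    (ν₁ ν₂ : Measure S) [IsFiniteMeasure ν₁] [IsFiniteMeasure ν₂] :
    tvDist (ν₁.map φ) (ν₂.map φ) ≤ tvDist ν₁ ν₂ := by
  rw [← Measure.deterministic_comp_eq_map hφ, ← Measure.deterministic_comp_eq_map hφ]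
  exact tvDist_comp_le _ _ _

lemma tvDist_lt_one_of_not_mutuallySingular {ν₁ ν₂ : Measure S} [IsProbabilityMeasure ν₁]
    [IsProbabilityMeasure ν₂] (h : ¬ ν₁ ⟂ₘ ν₂) : tvDist ν₁ ν₂ < 1 := by
  obtain ⟨m, a, b, h₁, h₂, hab⟩ := exists_common_add_mutuallySingular ν₁ ν₂
  have := isFiniteMeasure_left_of_eq_add h₁
  have := isFiniteMeasure_right_of_eq_add h₁
  have := isFiniteMeasure_right_of_eq_add h₂
  have hm : 0 < m.real Set.univ := by
    refine measureReal_nonneg.lt_of_ne' fun h0 => h ?_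
    have : m = 0 := by
      rwa [measureReal_eq_zero_iff, Measure.measure_univ_eq_zero] at h0
    rw [h₁, h₂, this, zero_add, zero_add]
    exact hab
  have ha : m.real Set.univ + a.real Set.univ = 1 := by
    rw [← measureReal_add_apply, ← h₁, probReal_univ]
  have hb : m.real Set.univ + b.real Set.univ = 1 := by
    rw [← measureReal_add_apply, ← h₂, probReal_univ]
  rw [h₁, h₂]
  exact (tvDist_add_left_le m a b).trans_lt (max_lt (by linarith) (by linarith))

/-- On a countably generated space countably many sets suffice for the total variation
distance of all pairs of finite measures. -/
lemma exists_countable_forall_tvDist_le [MeasurableSpace.CountablyGenerated S] :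
    ∃ 𝒜 : Set (Set S), 𝒜.Countable ∧ 𝒜.Nonempty ∧ (∀ A ∈ 𝒜, MeasurableSet A) ∧
      ∀ (ν₁ ν₂ : Measure S) [IsFiniteMeasure ν₁] [IsFiniteMeasure ν₂],
        tvDist ν₁ ν₂ = ⨆ A : 𝒜, |ν₁.real A - ν₂.real A| := by
  let 𝒜 := generateSetAlgebra (MeasurableSpace.countableGeneratingSet S)
  have hgen : ‹MeasurableSpace S› = MeasurableSpace.generateFrom 𝒜 := by
    rw [generateFrom_generateSetAlgebra_eq]
    exact (MeasurableSpace.generateFrom_countableGeneratingSet).symm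
  have hne : 𝒜.Nonempty := ⟨∅, isSetAlgebra_generateSetAlgebra.empty_mem⟩
  have hmeas : ∀ A ∈ 𝒜, MeasurableSet A := fun A hA => by
    rw [hgen]; exact MeasurableSpace.measurableSet_generateFrom hA
  refine ⟨𝒜, countable_generateSetAlgebra MeasurableSpace.countable_countableGeneratingSet,
    hne, hmeas, ?_⟩
  intro ν₁ ν₂ _ _
  have : Nonempty 𝒜 := hne.to_subtype
  refine le_antisymm (tvDist_le fun A hA => le_of_forall_pos_le_add fun ε hε => ?_)
    (ciSup_le fun A => abs_real_sub_real_le_tvDist _ _ (hmeas A A.2))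
  have hb : BddAbove (Set.range fun A : 𝒜 => |ν₁.real A - ν₂.real A|) := by
    refine ⟨tvDist ν₁ ν₂, ?_⟩
    rintro _ ⟨B, rfl⟩
    exact abs_real_sub_real_le_tvDist _ _ (hmeas B B.2)
  -- Approximating `A` with respect to the sum controls the errors under both measures together.
  obtain ⟨B, hB, hAB⟩ := (Measure.MeasureDense.of_generateFrom_isSetAlgebra_finite (ν₁ + ν₂)
    isSetAlgebra_generateSetAlgebra hgen).approx A hA (measure_ne_top _ _) ε hε
  have h₁ := abs_measureReal_sub_le_measureReal_symmDiff (μ := ν₁) hA.nullMeasurableSet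
    (hmeas B hB).nullMeasurableSet
  have h₂ := abs_measureReal_sub_le_measureReal_symmDiff (μ := ν₂) hA.nullMeasurableSet
    (hmeas B hB).nullMeasurableSet
  have h₃ : ν₁.real (symmDiff A B) + ν₂.real (symmDiff A B) < ε := by
    rw [← measureReal_add_apply]
    exact (ENNReal.lt_ofReal_iff_toReal_lt (measure_ne_top _ _)).1 hAB
  have h₄ : |ν₁.real B - ν₂.real B| ≤ ⨆ A : 𝒜, |ν₁.real A - ν₂.real A| :=
    le_ciSup hb (⟨B, hB⟩ : 𝒜)
  rw [abs_le] at h₁ h₂ h₄ ⊢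
  exact ⟨by linarith, by linarith⟩

lemma measurable_tvDist [MeasurableSpace.CountablyGenerated S] {T : Type*} [MeasurableSpace T]
    (κ η : Kernel T S) [IsMarkovKernel κ] [IsMarkovKernel η] :
    Measurable fun t => tvDist (κ t) (η t) := by
  obtain ⟨𝒜, hc, -, hm, h⟩ := exists_countable_forall_tvDist_le (S := S)
  have : Countable 𝒜 := hc.to_subtype
  simp only [h]
  refine Measurable.iSup fun A => ?_
  have h₁ : Measurable fun t => (κ t).real A :=
    (Kernel.measurable_coe κ (hm A A.2)).ennreal_toReal
  have h₂ : Measurable fun t => (η t).real A :=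
    (Kernel.measurable_coe η (hm A A.2)).ennreal_toReal
  exact (h₁.sub h₂).abs

end TotalVariation

/-! ### Couplings that are maximal for a whole sequence of maps. -/

section Gluing

variable {S T : Type*} [MeasurableSpace S] [MeasurableSpace T]

lemma map_withDensity_comp {φ : S → T} (hφ : Measurable φ) (κ : Measure S) {g : T → ENNReal}
    (hg : Measurable g) : (κ.withDensity (g ∘ φ)).map φ = (κ.map φ).withDensity g := by
  ext A hA
  rw [Measure.map_apply hφ hA, withDensity_apply _ (hφ hA), withDensity_apply _ hA,
    setLIntegral_map hA hg hφ]
  rfl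

/-- A splitting of the image of a finite measure lifts to a splitting of the measure. -/
lemma exists_lift_of_map_eq_add {φ : S → T} (hφ : Measurable φ) {κ : Measure S}
    [IsFiniteMeasure κ] {m a : Measure T} (h : κ.map φ = m + a) :
    ∃ l r : Measure S, κ = l + r ∧ l.map φ = m ∧ r.map φ = a := by
  have := isFiniteMeasure_left_of_eq_add h
  have := isFiniteMeasure_right_of_eq_add h
  have hm : m ≪ κ.map φ := (Measure.le_add_right le_rfl : m ≤ m + a).absolutelyContinuous.trans
    (h ▸ Measure.AbsolutelyContinuous.rfl)
  have ha : a ≪ κ.map φ := (Measure.le_add_left le_rfl : a ≤ m + a).absolutelyContinuous.trans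
    (h ▸ Measure.AbsolutelyContinuous.rfl)
  -- The densities of the two parts of the image sum to 1 almost everywhere; pulled back along `φ`,
  -- they split `κ`.
  refine ⟨κ.withDensity (m.rnDeriv (κ.map φ) ∘ φ), κ.withDensity (a.rnDeriv (κ.map φ) ∘ φ),
    ?_, ?_, ?_⟩
  · rw [← withDensity_add_left ((Measure.measurable_rnDeriv _ _).comp hφ)]
    have h1 : m.rnDeriv (κ.map φ) + a.rnDeriv (κ.map φ) =ᵐ[κ.map φ] fun _ => 1 := by
      refine (Measure.rnDeriv_add' m a (κ.map φ)).symm.trans ?_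
      rw [← h]
      exact Measure.rnDeriv_self _
    have h2 := ae_of_ae_map hφ.aemeasurable h1
    conv_lhs => rw [← withDensity_one (μ := κ)]
    refine withDensity_congr_ae ?_
    filter_upwards [h2] with s hs
    simpa using hs.symm
  · rw [map_withDensity_comp hφ _ (Measure.measurable_rnDeriv _ _),
      Measure.withDensity_rnDeriv_eq _ _ hm]
  · rw [map_withDensity_comp hφ _ (Measure.measurable_rnDeriv _ _),
      Measure.withDensity_rnDeriv_eq _ _ ha]

lemma exists_maximal_common_image {φ : S → T} (hφ : Measurable φ) (κ₁ κ₂ : Measure S)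
    [IsFiniteMeasure κ₁] [IsFiniteMeasure κ₂] :
    ∃ l₁ r₁ l₂ r₂ : Measure S, κ₁ = l₁ + r₁ ∧ κ₂ = l₂ + r₂ ∧ l₁.map φ = l₂.map φ ∧
      r₁.map φ ⟂ₘ r₂.map φ := by
  obtain ⟨m, a, b, h₁, h₂, hab⟩ := exists_common_add_mutuallySingular (κ₁.map φ) (κ₂.map φ)
  obtain ⟨l₁, r₁, e₁, rfl, rfl⟩ := exists_lift_of_map_eq_add hφ h₁
  obtain ⟨l₂, r₂, e₂, hl, rfl⟩ := exists_lift_of_map_eq_add hφ h₂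
  exact ⟨l₁, r₁, l₂, r₂, e₁, e₂, hl.symm, hab⟩

/-- Measures with the same image under `φ` have a coupling under which the values of `φ` agree. -/
lemma exists_isCoupling_of_map_eq [StandardBorelSpace S] [Nonempty S] [MeasurableEq T]
    {φ : S → T} (hφ : Measurable φ) {l₁ l₂ : Measure S} [IsFiniteMeasure l₁] [IsFiniteMeasure l₂]
    (h : l₁.map φ = l₂.map φ) :
    ∃ ξ : Measure (S × S), IsCoupling l₁ l₂ ξ ∧ ∀ᵐ z ∂ξ, φ z.1 = φ z.2 := by
  let K₁ : Kernel T S := condDistrib id φ l₁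
  let K₂ : Kernel T S := condDistrib id φ l₂
  have c₁ : l₁.map φ ⊗ₘ K₁ = l₁.map fun s => (φ s, s) :=
    compProd_map_condDistrib aemeasurable_id
  have c₂ : l₁.map φ ⊗ₘ K₂ = l₂.map fun s => (φ s, s) :=
    h ▸ compProd_map_condDistrib aemeasurable_id
  have hS : MeasurableSet {p : T × S | φ p.2 = p.1} :=
    measurableSet_eq_fun (hφ.comp measurable_snd) measurable_fst
  have a₁ : ∀ᵐ t ∂(l₁.map φ), ∀ᵐ s ∂(K₁ t), φ s = t := by
    refine Measure.ae_ae_of_ae_compProd (p := fun p : T × S => φ p.2 = p.1) ?_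
    rw [c₁, ae_map_iff (by fun_prop) hS]
    simp
  have a₂ : ∀ᵐ t ∂(l₁.map φ), ∀ᵐ s ∂(K₂ t), φ s = t := by
    refine Measure.ae_ae_of_ae_compProd (p := fun p : T × S => φ p.2 = p.1) ?_
    rw [c₂, ae_map_iff (by fun_prop) hS]
    simp
  -- Draw the common value of `φ`, then two independent points from the conditional laws, which live
  -- on its fibre.
  refine ⟨(K₁ ×ₖ K₂) ∘ₘ (l₁.map φ), ⟨?_, ?_⟩, ?_⟩
  · rw [Measure.fst, Measure.map_comp _ _ measurable_fst, ← Kernel.fst_eq, Kernel.fst_prod,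
      ← Measure.snd_compProd, c₁, Measure.snd_map_prodMk hφ]
    exact Measure.map_id
  · rw [Measure.snd, Measure.map_comp _ _ measurable_snd, ← Kernel.snd_eq, Kernel.snd_prod,
      ← Measure.snd_compProd, c₂, Measure.snd_map_prodMk hφ]
    exact Measure.map_id
  · refine Measure.ae_comp_of_ae_ae
      (measurableSet_eq_fun (hφ.comp measurable_fst) (hφ.comp measurable_snd)) ?_
    filter_upwards [a₁, a₂] with t h₁ h₂
    rw [Kernel.prod_apply]
    filter_upwards [Measure.quasiMeasurePreserving_fst.ae h₁,
      Measure.quasiMeasurePreserving_snd.ae h₂] with z hz₁ hz₂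
    exact hz₁.trans hz₂.symm

lemma IsCoupling.isFiniteMeasure {κ₁ κ₂ : Measure S} [IsFiniteMeasure κ₁] {ξ : Measure (S × S)}
    (h : IsCoupling κ₁ κ₂ ξ) : IsFiniteMeasure ξ :=
  ⟨by rw [← Measure.fst_univ, h.1]; exact measure_lt_top _ _⟩

/-- The normalised product works. Absolute continuity will let statements that hold almost surely
for independent chains pass to this coupling. -/
lemma exists_isCoupling {κ₁ κ₂ : Measure S} [IsFiniteMeasure κ₁] [IsFiniteMeasure κ₂]
    (h : κ₁ Set.univ = κ₂ Set.univ) :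
    ∃ ξ : Measure (S × S), IsCoupling κ₁ κ₂ ξ ∧ ξ ≪ κ₁.prod κ₂ := by
  rcases eq_or_ne (κ₁ Set.univ) 0 with h0 | h0
  · refine ⟨0, ⟨?_, ?_⟩, Measure.AbsolutelyContinuous.zero _⟩
    · rw [Measure.measure_univ_eq_zero.1 h0]; simp
    · rw [Measure.measure_univ_eq_zero.1 (h.symm.trans h0)]; simp
  · refine ⟨(κ₁ Set.univ)⁻¹ • κ₁.prod κ₂, ⟨?_, ?_⟩, Measure.smul_absolutelyContinuous⟩
    · rw [Measure.fst, Measure.map_smul, Measure.map_fst_prod, smul_smul, ← h,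
        ENNReal.inv_mul_cancel h0 (measure_ne_top _ _), one_smul]
    · rw [Measure.snd, Measure.map_smul, Measure.map_snd_prod, smul_smul,
        ENNReal.inv_mul_cancel h0 (measure_ne_top _ _), one_smul]

lemma IsCoupling.add {κ₁ κ₂ η₁ η₂ : Measure S} {ξ ζ : Measure (S × S)}
    (hξ : IsCoupling κ₁ κ₂ ξ) (hζ : IsCoupling η₁ η₂ ζ) :
    IsCoupling (κ₁ + η₁) (κ₂ + η₂) (ξ + ζ) := by
  refine ⟨?_, ?_⟩
  · rw [Measure.fst, Measure.map_add _ _ measurable_fst, ← Measure.fst, ← Measure.fst, hξ.1, hζ.1]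
  · rw [Measure.snd, Measure.map_add _ _ measurable_snd, ← Measure.snd, ← Measure.snd, hξ.2, hζ.2]

lemma IsCoupling.sum {ι : Type*} [Countable ι] {κ₁ κ₂ : ι → Measure S}
    {ξ : ι → Measure (S × S)} (hξ : ∀ i, IsCoupling (κ₁ i) (κ₂ i) (ξ i)) :
    IsCoupling (Measure.sum κ₁) (Measure.sum κ₂) (Measure.sum ξ) := by
  refine ⟨?_, ?_⟩
  · rw [Measure.fst, Measure.map_sum measurable_fst.aemeasurable]
    exact congrArg _ (funext fun i => (hξ i).1)
  · rw [Measure.snd, Measure.map_sum measurable_snd.aemeasurable]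
    exact congrArg _ (funext fun i => (hξ i).2)

/-- The coupled parts and the remainders when, one after the other, common images under the maps
`θ n` are removed from `κ₁` and `κ₂`. -/
lemma exists_successive_splitting {θ : ℕ → S → T} (hθ : ∀ n, Measurable (θ n)) (κ₁ κ₂ : Measure S)
    [IsFiniteMeasure κ₁] [IsFiniteMeasure κ₂] :
    ∃ l₁ l₂ r₁ r₂ : ℕ → Measure S, r₁ 0 = κ₁ ∧ r₂ 0 = κ₂ ∧ (∀ n, IsFiniteMeasure (r₁ n)) ∧
      (∀ n, IsFiniteMeasure (r₂ n)) ∧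
      ∀ n, r₁ n = l₁ n + r₁ (n + 1) ∧ r₂ n = l₂ n + r₂ (n + 1) ∧
        (l₁ n).map (θ n) = (l₂ n).map (θ n) ∧
        (r₁ (n + 1)).map (θ n) ⟂ₘ (r₂ (n + 1)).map (θ n) := by
  let St := {p : Measure S × Measure S // IsFiniteMeasure p.1 ∧ IsFiniteMeasure p.2}
  have step : ∀ (n : ℕ) (p : St), ∃ (l : Measure S × Measure S) (q : St),
      p.1.1 = l.1 + q.1.1 ∧ p.1.2 = l.2 + q.1.2 ∧ l.1.map (θ n) = l.2.map (θ n) ∧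
        q.1.1.map (θ n) ⟂ₘ q.1.2.map (θ n) := by
    rintro n ⟨⟨a, b⟩, ha, hb⟩
    dsimp only at ha hb
    obtain ⟨l, r, l', r', h, h', e, s⟩ := exists_maximal_common_image (hθ n) a b
    exact ⟨(l, l'), ⟨(r, r'), isFiniteMeasure_right_of_eq_add h,
      isFiniteMeasure_right_of_eq_add h'⟩, h, h', e, s⟩
  choose l q hq using step
  let p : ℕ → St := fun n => Nat.rec ⟨(κ₁, κ₂), ‹_›, ‹_›⟩ q n
  exact ⟨fun n => (l n (p n)).1, fun n => (l n (p n)).2, fun n => (p n).1.1, fun n => (p n).1.2,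
    rfl, rfl, fun n => (p n).2.1, fun n => (p n).2.2, fun n => hq n (p n)⟩

lemma eq_sum_range_add {r l : ℕ → Measure S} (h : ∀ n, r n = l n + r (n + 1)) (n : ℕ) :
    r 0 = ∑ k ∈ Finset.range n, l k + r n := by
  induction n with
  | zero => simp
  | succ n ih => rw [Finset.sum_range_succ, add_assoc, ← h n, ih]

lemma sum_le_of_forall_eq_add {r l : ℕ → Measure S} (h : ∀ n, r n = l n + r (n + 1)) :
    Measure.sum l ≤ r 0 := by
  refine Measure.le_iff.2 fun A hA => ?_
  rw [Measure.sum_apply _ hA, ENNReal.tsum_eq_iSup_nat]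
  refine iSup_le fun n => ?_
  rw [eq_sum_range_add h n, Measure.add_apply, Measure.finsetSum_apply]
  exact le_self_add

/-- A coupling that is simultaneously maximal for all maps `θ n`, each a function of the previous
one: the values of `θ n` differ with probability at most the total variation distance of their
laws. -/
theorem exists_isCoupling_forall_le_tvDist [StandardBorelSpace S] [Nonempty S] [MeasurableEq T]
    {θ : ℕ → S → T} (hθ : ∀ n, Measurable (θ n)) {σ : T → T} (hσ : Measurable σ)
    (hθσ : ∀ n, θ (n + 1) = σ ∘ θ n) (κ₁ κ₂ : Measure S) [IsProbabilityMeasure κ₁]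
    [IsProbabilityMeasure κ₂] :
    ∃ ξ : Measure (S × S), IsCoupling κ₁ κ₂ ξ ∧
      ∀ n, ξ {z | θ n z.1 ≠ θ n z.2} ≤
        ENNReal.ofReal (tvDist (κ₁.map (θ n)) (κ₂.map (θ n))) := by
  obtain ⟨l₁, l₂, r₁, r₂, h01, h02, hf₁, hf₂, H⟩ := exists_successive_splitting hθ κ₁ κ₂
  have H₁ : ∀ n, r₁ n = l₁ n + r₁ (n + 1) := fun n => (H n).1
  have H₂ : ∀ n, r₂ n = l₂ n + r₂ (n + 1) := fun n => (H n).2.1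
  have fl₁ : ∀ n, IsFiniteMeasure (l₁ n) := fun n => isFiniteMeasure_left_of_eq_add (H₁ n)
  have fl₂ : ∀ n, IsFiniteMeasure (l₂ n) := fun n => isFiniteMeasure_left_of_eq_add (H₂ n)
  -- Later maps factor through earlier ones, so a pair matched at stage `k` stays matched at every
  -- later stage.
  have hiter : ∀ k n, k ≤ n → ∃ τ : T → T, Measurable τ ∧ θ n = τ ∘ θ k := by
    intro k n hkn
    induction n, hkn using Nat.le_induction with
    | base => exact ⟨id, measurable_id, rfl⟩
    | succ n _ ih =>
      obtain ⟨τ, hτ, e⟩ := ih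
      exact ⟨σ ∘ τ, hσ.comp hτ, by rw [hθσ n, e]; rfl⟩
  have hmap : ∀ k n, k ≤ n → (l₁ k).map (θ n) = (l₂ k).map (θ n) := by
    intro k n hkn
    obtain ⟨τ, hτ, e⟩ := hiter k n hkn
    rw [e, ← Measure.map_map hτ (hθ k), ← Measure.map_map hτ (hθ k), (H k).2.2.1]
  -- Pieces `0, …, n` have equal images under `θ n`, while the remainders of index `n + 1` have
  -- singular ones.
  have hrem : ∀ n, (r₁ (n + 1)).real Set.univ ≤ tvDist (κ₁.map (θ n)) (κ₂.map (θ n)) := by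
    intro n
    have e₁ := eq_sum_range_add H₁ (n + 1)
    have e₂ := eq_sum_range_add H₂ (n + 1)
    rw [h01] at e₁
    rw [h02] at e₂
    have hL : (∑ k ∈ Finset.range (n + 1), l₁ k).map (θ n) =
        (∑ k ∈ Finset.range (n + 1), l₂ k).map (θ n) := by
      rw [← Measure.mapₗ_apply_of_measurable (hθ n), ← Measure.mapₗ_apply_of_measurable (hθ n),
        map_sum, map_sum]
      refine Finset.sum_congr rfl fun k hk => ?_
      rw [Measure.mapₗ_apply_of_measurable (hθ n), Measure.mapₗ_apply_of_measurable (hθ n)]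
      exact hmap k n (Nat.lt_succ_iff.1 (Finset.mem_range.1 hk))
    have := isFiniteMeasure_left_of_eq_add e₂
    have hle := real_univ_le_tvDist (m := (∑ k ∈ Finset.range (n + 1), l₂ k).map (θ n))
      (H n).2.2.2
    rw [e₁, e₂, Measure.map_add _ _ (hθ n), Measure.map_add _ _ (hθ n), hL]
    refine le_trans (le_of_eq ?_) hle
    rw [map_measureReal_apply (hθ n) MeasurableSet.univ, Set.preimage_univ]
  have hglue : ∀ n, ∃ ξ : Measure (S × S), IsCoupling (l₁ n) (l₂ n) ξ ∧
      ∀ᵐ z ∂ξ, θ n z.1 = θ n z.2 := fun n => exists_isCoupling_of_map_eq (hθ n) (H n).2.2.1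
  choose ξ hξ hξe using hglue
  have mass : ∀ n, l₁ n Set.univ = l₂ n Set.univ := fun n => by
    rw [← (hξ n).1, ← (hξ n).2, Measure.fst_univ, Measure.snd_univ]
  have le₁ : Measure.sum l₁ ≤ κ₁ := h01 ▸ sum_le_of_forall_eq_add H₁
  have le₂ : Measure.sum l₂ ≤ κ₂ := h02 ▸ sum_le_of_forall_eq_add H₂
  have fs₁ : IsFiniteMeasure (Measure.sum l₁) := isFiniteMeasure_of_le _ le₁
  have fs₂ : IsFiniteMeasure (Measure.sum l₂) := isFiniteMeasure_of_le _ le₂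
  have hmass : (κ₁ - Measure.sum l₁) Set.univ = (κ₂ - Measure.sum l₂) Set.univ := by
    rw [Measure.sub_apply MeasurableSet.univ le₁, Measure.sub_apply MeasurableSet.univ le₂,
      measure_univ (μ := κ₁), measure_univ (μ := κ₂), Measure.sum_apply _ MeasurableSet.univ,
      Measure.sum_apply _ MeasurableSet.univ]
    simp only [mass]
  -- The mass never matched at any stage may be coupled arbitrarily.
  obtain ⟨ζ, hζ, -⟩ := exists_isCoupling hmass
  have hc := (IsCoupling.sum hξ).add hζ
  rw [add_comm (Measure.sum l₁), add_comm (Measure.sum l₂), Measure.sub_add_cancel_of_le le₁,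
    Measure.sub_add_cancel_of_le le₂] at hc
  refine ⟨_, hc, fun n => ?_⟩
  set D : Set (S × S) := {z | θ n z.1 ≠ θ n z.2} with hD
  have hDm : MeasurableSet D := (measurableSet_eq_fun ((hθ n).comp measurable_fst)
    ((hθ n).comp measurable_snd)).compl
  have hzero : ∀ k ∈ Finset.range (n + 1), ξ k D = 0 := fun k hk => by
    obtain ⟨τ, -, e⟩ := hiter k n (Nat.lt_succ_iff.1 (Finset.mem_range.1 hk))
    refine measure_mono_null (fun z hz => ?_) (ae_iff.1 (hξe k))
    intro hz'
    exact hz (by rw [e]; exact congrArg τ hz')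
  -- Disagreement under `θ n` can come only from pieces of index above `n` and from `ζ`; their total
  -- mass is that of the remainder.
  have hbound : (Measure.sum ξ + ζ) D ≤ (r₁ (n + 1)) Set.univ := by
    have hsplit : (Measure.sum ξ) D ≤ ∑' k, l₁ (k + (n + 1)) Set.univ := by
      rw [Measure.sum_apply _ hDm, ← (ENNReal.summable).sum_add_tsum_nat_add' (k := n + 1),
        Finset.sum_eq_zero hzero, zero_add]
      refine ENNReal.tsum_le_tsum fun k => (measure_mono (Set.subset_univ _)).trans (le_of_eq ?_)
      rw [← (hξ _).1, Measure.fst_univ]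
    have hζu : ζ D ≤ (κ₁ - Measure.sum l₁) Set.univ :=
      (measure_mono (Set.subset_univ _)).trans (le_of_eq (by rw [← hζ.1, Measure.fst_univ]))
    have hfin : (∑ k ∈ Finset.range (n + 1), l₁ k) Set.univ ≠ ⊤ := by
      have := isFiniteMeasure_left_of_eq_add (h01 ▸ eq_sum_range_add H₁ (n + 1))
      exact measure_ne_top _ _
    refine (ENNReal.add_le_add_iff_left hfin).1 ?_
    rw [← Measure.add_apply _ (r₁ (n + 1)), ← eq_sum_range_add H₁ (n + 1), h01, Measure.add_apply]
    calc _ ≤ (∑ k ∈ Finset.range (n + 1), l₁ k) Set.univ +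
          (∑' k, l₁ (k + (n + 1)) Set.univ + (κ₁ - Measure.sum l₁) Set.univ) := by gcongr
      _ = Measure.sum l₁ Set.univ + (κ₁ - Measure.sum l₁) Set.univ := by
        rw [← add_assoc, Measure.finsetSum_apply, (ENNReal.summable).sum_add_tsum_nat_add' (k := n + 1),
          Measure.sum_apply _ MeasurableSet.univ]
      _ = κ₁ Set.univ := by
        rw [← Measure.add_apply, add_comm, Measure.sub_add_cancel_of_le le₁]
  refine hbound.trans ?_
  rw [← ofReal_measureReal]
  exact ENNReal.ofReal_le_ofReal (hrem n)

end Gluing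

/-! ### Path laws, the Markov property under shifts, and coupling of chains. -/

section MarkovChain

variable {E : Type*} [MeasurableSpace E]

instance isMarkovKernel_pow (P : Kernel E E) [IsMarkovKernel P] (n : ℕ) :
    IsMarkovKernel (P ^ n) := by
  induction n with
  | zero => exact inferInstanceAs (IsMarkovKernel (Kernel.id : Kernel E E))
  | succ n ih => rw [pow_succ']; exact inferInstanceAs (IsMarkovKernel (P ∘ₖ (P ^ n)))

lemma comap_comp_eq {S T U : Type*} [MeasurableSpace S] [MeasurableSpace T] [MeasurableSpace U]
    (κ : Kernel T U) {g : S → T} (hg : Measurable g) (ν : Measure S) :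
    κ.comap g hg ∘ₘ ν = κ ∘ₘ ν.map g := by
  ext A hA
  rw [Measure.bind_apply hA (Kernel.aemeasurable _), Measure.bind_apply hA (Kernel.aemeasurable _),
    lintegral_map (κ.measurable_coe hA) hg]
  rfl

lemma map_compProd_comap {S T U : Type*} [MeasurableSpace S] [MeasurableSpace T]
    [MeasurableSpace U] (κ : Kernel T U) [IsSFiniteKernel κ] {g : S → T} (hg : Measurable g)
    (ν : Measure S) [SFinite ν] :
    (ν ⊗ₘ κ.comap g hg).map (Prod.map g id) = ν.map g ⊗ₘ κ := by
  ext A hA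
  rw [Measure.map_apply (hg.prodMap measurable_id) hA,
    Measure.compProd_apply ((hg.prodMap measurable_id) hA), Measure.compProd_apply hA,
    lintegral_map (Kernel.measurable_kernel_prodMk_left hA) hg]
  rfl

/-- The transition kernels of the Markov chain with kernel `P`, as functions of the history. -/
noncomputable def stepKernel (P : Kernel E E) (n : ℕ) :
    Kernel ((i : Finset.Iic n) → E) E :=
  P.comap (fun h : (i : Finset.Iic n) → E => h ⟨n, Finset.mem_Iic.2 le_rfl⟩)
    (measurable_pi_apply _)

instance isMarkovKernel_stepKernel (P : Kernel E E) [IsMarkovKernel P] (n : ℕ) :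
    IsMarkovKernel (stepKernel P n) := by
  unfold stepKernel; infer_instance

/-- The law of the Markov chain with kernel `P` and initial distribution `ν`. -/
noncomputable def chainLawFrom (P : Kernel E E) [IsMarkovKernel P] (ν : Measure E) :
    Measure (ℕ → E) :=
  Kernel.trajMeasure (X := fun _ : ℕ => E) ν (stepKernel P)

lemma chainLaw_eq_chainLawFrom (P : Kernel E E) [IsMarkovKernel P] (x : E) :
    chainLaw P x = chainLawFrom P (Measure.dirac x) := rfl

instance isProbabilityMeasure_chainLawFrom (P : Kernel E E) [IsMarkovKernel P] (ν : Measure E)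
    [IsProbabilityMeasure ν] : IsProbabilityMeasure (chainLawFrom P ν) := by
  unfold chainLawFrom; infer_instance

/-- Markov property: given the history up to time `k`, the next state has law `P`. -/
def HasTransitions (P : Kernel E E) (ρ : Measure (ℕ → E)) : Prop :=
  ∀ k, ρ.map (Preorder.frestrictLe (π := fun _ : ℕ => E) k) ⊗ₘ stepKernel P k =
    ρ.map fun ω => (Preorder.frestrictLe (π := fun _ : ℕ => E) k ω, ω (k + 1))

lemma hasTransitions_chainLawFrom (P : Kernel E E) [IsMarkovKernel P] (ν : Measure E)
    [IsProbabilityMeasure ν] : HasTransitions P (chainLawFrom P ν) :=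
  fun _ => Kernel.map_frestrictLe_trajMeasure_compProd_eq_map_trajMeasure

lemma map_eval_zero_chainLawFrom (P : Kernel E E) [IsMarkovKernel P] (ν : Measure E) :
    (chainLawFrom P ν).map (fun ω => ω 0) = ν := by
  have h : (fun ω : ℕ → E => ω 0) = (fun h : (i : Finset.Iic 0) → E => h ⟨0, by simp⟩) ∘
      Preorder.frestrictLe (π := fun _ : ℕ => E) 0 := rfl
  rw [h, ← Measure.map_map (by fun_prop) (by fun_prop), chainLawFrom, Kernel.trajMeasure,
    Measure.map_comp _ _ (by fun_prop), Kernel.traj_map_frestrictLe, Kernel.partialTraj_self,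
    Measure.id_comp, Measure.map_map (by fun_prop) (by fun_prop)]
  exact Measure.map_id

/-- The law of a Markov chain is determined by its initial distribution and its kernel. -/
lemma HasTransitions.ext {P : Kernel E E} [IsMarkovKernel P] {ρ₁ ρ₂ : Measure (ℕ → E)}
    [IsFiniteMeasure ρ₁] (h₁ : HasTransitions P ρ₁)
    (h₂ : HasTransitions P ρ₂) (h₀ : ρ₁.map (fun ω => ω 0) = ρ₂.map (fun ω => ω 0)) :
    ρ₁ = ρ₂ := by
  -- The laws of the initial segments agree by induction on length, and they determine all
  -- finite-dimensional marginals.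
  have key : ∀ k, ρ₁.map (Preorder.frestrictLe (π := fun _ : ℕ => E) k) =
      ρ₂.map (Preorder.frestrictLe (π := fun _ : ℕ => E) k) := by
    intro k
    induction k with
    | zero =>
      have e : Preorder.frestrictLe (π := fun _ : ℕ => E) 0 =
          (fun (x : E) (_ : Finset.Iic 0) => x) ∘ (fun ω : ℕ → E => ω 0) := by
        funext ω i
        obtain ⟨i, hi⟩ := i
        obtain rfl : i = 0 := by simpa using hi
        rfl
      rw [e, ← Measure.map_map (by fun_prop) (by fun_prop),
        ← Measure.map_map (by fun_prop) (by fun_prop), h₀]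
    | succ k ih =>
      let g : ((i : Finset.Iic k) → E) × E → ((i : Finset.Iic (k + 1)) → E) :=
        fun p i => if h : (i : ℕ) ≤ k then p.1 ⟨i, Finset.mem_Iic.2 h⟩ else p.2
      have hg : Measurable g := by
        refine measurable_pi_lambda _ fun i => ?_
        by_cases h : (i : ℕ) ≤ k
        · simp only [g, h, dif_pos]; fun_prop
        · simp only [g, h, dif_neg, not_false_eq_true]; fun_prop
      have e : Preorder.frestrictLe (π := fun _ : ℕ => E) (k + 1) =
          g ∘ fun ω => (Preorder.frestrictLe (π := fun _ : ℕ => E) k ω, ω (k + 1)) := by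
        funext ω i
        obtain ⟨i, hi⟩ := i
        by_cases h : i ≤ k
        · simp [g, h]
        · obtain rfl : i = k + 1 := le_antisymm (Finset.mem_Iic.1 hi) (by omega)
          simp [g]
      rw [e, ← Measure.map_map hg (by fun_prop), ← Measure.map_map hg (by fun_prop), ← h₁ k,
        ← h₂ k, ih]
  have hlim : ∀ ρ : Measure (ℕ → E), ∀ I : Finset ℕ, ρ.map I.restrict =
      (ρ.map (Preorder.frestrictLe (π := fun _ : ℕ => E) (I.sup id))).map
        (fun h (i : I) => h ⟨i, Finset.mem_Iic.2 (Finset.le_sup (f := id) i.2)⟩) := by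
    intro ρ I
    rw [Measure.map_map (by fun_prop) (by fun_prop)]
    rfl
  refine IsProjectiveLimit.unique (P := fun I => ρ₁.map I.restrict) (fun I => rfl) fun I => ?_
  rw [hlim ρ₂, ← key, ← hlim]

/-- The path after time `n`. -/
def shift {F : Type*} (n : ℕ) (ω : ℕ → F) : ℕ → F := fun k => ω (k + n)

lemma shift_succ {F : Type*} (n : ℕ) : shift (F := F) (n + 1) = shift 1 ∘ shift n := by
  funext ω k
  simp only [shift, Function.comp]
  congr 1
  omega

@[fun_prop]
lemma measurable_shift (n : ℕ) : Measurable (shift (F := E) n) :=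
  measurable_pi_lambda _ fun _ => measurable_pi_apply _

lemma HasTransitions.map_shift {P : Kernel E E} [IsMarkovKernel P] {ρ : Measure (ℕ → E)}
    [IsFiniteMeasure ρ] (h : HasTransitions P ρ) (n : ℕ) :
    HasTransitions P (ρ.map (shift n)) := by
  intro k
  let g : ((i : Finset.Iic (k + n)) → E) → ((i : Finset.Iic k) → E) :=
    fun p i => p ⟨i + n, Finset.mem_Iic.2 (Nat.add_le_add_right (Finset.mem_Iic.1 i.2) n)⟩
  have hg : Measurable g := by fun_prop
  have e₁ : Preorder.frestrictLe (π := fun _ : ℕ => E) k ∘ shift n =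
      g ∘ Preorder.frestrictLe (π := fun _ : ℕ => E) (k + n) := rfl
  have e₂ : (fun ω => (Preorder.frestrictLe (π := fun _ : ℕ => E) k ω, ω (k + 1))) ∘ shift n =
      Prod.map g id ∘
        fun ω => (Preorder.frestrictLe (π := fun _ : ℕ => E) (k + n) ω, ω (k + n + 1)) := by
    funext ω
    refine Prod.ext rfl ?_
    simp only [shift, Function.comp, Prod.map_snd, id]
    congr 1
    omega
  have e₃ : stepKernel P (k + n) = (stepKernel P k).comap g hg := rfl
  rw [Measure.map_map (by fun_prop) (by fun_prop), Measure.map_map (by fun_prop) (by fun_prop),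
    e₁, e₂, ← Measure.map_map hg (by fun_prop),
    ← Measure.map_map (hg.prodMap measurable_id) (by fun_prop), ← h (k + n), e₃,
    map_compProd_comap]

lemma map_eval_chainLawFrom (P : Kernel E E) [IsMarkovKernel P] (ν : Measure E)
    [IsProbabilityMeasure ν] (n : ℕ) :
    (chainLawFrom P ν).map (fun ω => ω n) = (P ^ n) ∘ₘ ν := by
  induction n with
  | zero =>
    rw [map_eval_zero_chainLawFrom, pow_zero]
    exact Measure.id_comp.symm
  | succ n ih =>
    have h := congrArg Measure.snd (hasTransitions_chainLawFrom P ν n)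
    rw [Measure.snd_compProd, Measure.snd_map_prodMk (by fun_prop), stepKernel, comap_comp_eq,
      Measure.map_map (by fun_prop) (by fun_prop)] at h
    rw [← h, pow_succ']
    change P ∘ₘ ((chainLawFrom P ν).map fun ω => ω n) = (P ∘ₖ (P ^ n)) ∘ₘ ν
    rw [ih, Measure.comp_assoc]

lemma map_shift_chainLawFrom (P : Kernel E E) [IsMarkovKernel P] (ν : Measure E)
    [IsProbabilityMeasure ν] (n : ℕ) :
    (chainLawFrom P ν).map (shift n) = chainLawFrom P ((P ^ n : Kernel E E) ∘ₘ ν) := by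
  refine ((hasTransitions_chainLawFrom P ν).map_shift n).ext (hasTransitions_chainLawFrom P _) ?_
  rw [map_eval_zero_chainLawFrom, Measure.map_map (by fun_prop) (by fun_prop),
    ← map_eval_chainLawFrom]
  congr 1
  funext ω
  simp [shift]

/-- The path law is the image of the initial law under a Markov kernel. Hence the laws of the paths
after time n are no farther apart than the states at time n. -/
lemma tvDist_chainLawFrom_le (P : Kernel E E) [IsMarkovKernel P] (ν₁ ν₂ : Measure E)
    [IsFiniteMeasure ν₁] [IsFiniteMeasure ν₂] :
    tvDist (chainLawFrom P ν₁) (chainLawFrom P ν₂) ≤ tvDist ν₁ ν₂ :=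
  (tvDist_comp_le _ _ _).trans (tvDist_map_le (MeasurableEquiv.measurable _) _ _)

/-- Two chains can be coupled so that, for all `n` simultaneously, they disagree at some time
after `n` with probability at most the total variation distance of their laws at time `n`. -/
theorem exists_isChainCoupling {E : Type u} [MeasurableSpace E] [StandardBorelSpace E]
    (P : Kernel E E) [IsMarkovKernel P] (x y : E) :
    ∃ (Ω : Type u) (_ : MeasurableSpace Ω) (ρ : Measure Ω) (X Y : Ω → ℕ → E),
      IsChainCoupling P x y ρ X Y ∧
        ∀ n, 1 - ENNReal.ofReal (tvDist ((P ^ n) x) ((P ^ n) y)) ≤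
          ρ {ω | ∀ k ≥ n, X ω k = Y ω k} := by
  have : Nonempty E := ⟨x⟩
  obtain ⟨ξ, hξ, hle⟩ := exists_isCoupling_forall_le_tvDist (θ := shift (F := E))
    measurable_shift (measurable_shift 1) shift_succ (chainLawFrom P (Measure.dirac x))
    (chainLawFrom P (Measure.dirac y))
  have hp : IsProbabilityMeasure ξ := ⟨by rw [← Measure.fst_univ, hξ.1, measure_univ]⟩
  refine ⟨(ℕ → E) × (ℕ → E), inferInstance, ξ, Prod.fst, Prod.snd,
    ⟨hp, measurable_fst, measurable_snd, ?_⟩, fun n => ?_⟩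
  · rw [chainLaw_eq_chainLawFrom, chainLaw_eq_chainLawFrom]
    exact (Measure.map_id (μ := ξ)).symm ▸ hξ
  · have hset : {ω : (ℕ → E) × (ℕ → E) | ∀ k ≥ n, ω.1 k = ω.2 k} =
        {ω | shift n ω.1 ≠ shift n ω.2}ᶜ := by
      ext ω
      simp only [Set.mem_ofPred_eq, Set.mem_compl_iff, not_not]
      refine ⟨fun h => funext fun k => h _ (Nat.le_add_left _ _), fun h k hk => ?_⟩
      have := congrFun h (k - n)
      simpa only [shift, Nat.sub_add_cancel hk] using this
    have hm : MeasurableSet {ω : (ℕ → E) × (ℕ → E) | shift n ω.1 ≠ shift n ω.2} :=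
      (measurableSet_eq_fun ((measurable_shift n).comp measurable_fst)
        ((measurable_shift n).comp measurable_snd)).compl
    rw [hset, prob_compl_eq_one_sub hm]
    refine tsub_le_tsub_left ((hle n).trans (ENNReal.ofReal_le_ofReal ?_)) _
    rw [map_shift_chainLawFrom, map_shift_chainLawFrom, Measure.dirac_bind (Kernel.measurable _),
      Measure.dirac_bind (Kernel.measurable _)]
    exact tvDist_chainLawFrom_le _ _ _

end MarkovChain

/-! ### Subharmonic functions of a stationary chain. -/

section Subharmonic

variable {Z : Type*} [MeasurableSpace Z]

lemma integrable_of_mem_unitInterval {f : Z → ℝ} (hf : Measurable f) (h0 : ∀ z, 0 ≤ f z)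
    (h1 : ∀ z, f z ≤ 1) (Q : Measure Z) [IsFiniteMeasure Q] : Integrable f Q :=
  Integrable.of_bound hf.aestronglyMeasurable 1
    (ae_of_all _ fun z => by rw [Real.norm_of_nonneg (h0 z)]; exact h1 z)

/-- A bounded subharmonic function is constant along the steps of a stationary chain. -/
lemma ae_ae_eq_of_le_integral {π : Measure Z} [IsProbabilityMeasure π] {K : Kernel Z Z}
    [IsMarkovKernel K] (hK : K.Invariant π) {f : Z → ℝ} (hf : Measurable f) (h0 : ∀ z, 0 ≤ f z)
    (h1 : ∀ z, f z ≤ 1) (hsub : ∀ z, f z ≤ ∫ w, f w ∂(K z)) :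
    ∀ᵐ z ∂π, ∀ᵐ w ∂(K z), f w = f z := by
  have hf₁ : Measurable fun p : Z × Z => f p.1 := hf.comp measurable_fst
  have hf₂ : Measurable fun p : Z × Z => f p.2 := hf.comp measurable_snd
  have hsq : Integrable (fun z => f z * f z) π :=
    integrable_of_mem_unitInterval (hf.mul hf) (fun z => mul_nonneg (h0 z) (h0 z))
      (fun z => mul_le_one₀ (h1 z) (h0 z) (h1 z)) π
  have i11 : Integrable (fun p : Z × Z => f p.1 * f p.1) (π ⊗ₘ K) :=
    integrable_of_mem_unitInterval (hf₁.mul hf₁) (fun p => mul_nonneg (h0 _) (h0 _))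
      (fun p => mul_le_one₀ (h1 _) (h0 _) (h1 _)) _
  have i12 : Integrable (fun p : Z × Z => f p.1 * f p.2) (π ⊗ₘ K) :=
    integrable_of_mem_unitInterval (hf₁.mul hf₂) (fun p => mul_nonneg (h0 _) (h0 _))
      (fun p => mul_le_one₀ (h1 _) (h0 _) (h1 _)) _
  have i22 : Integrable (fun p : Z × Z => f p.2 * f p.2) (π ⊗ₘ K) :=
    integrable_of_mem_unitInterval (hf₂.mul hf₂) (fun p => mul_nonneg (h0 _) (h0 _))
      (fun p => mul_le_one₀ (h1 _) (h0 _) (h1 _)) _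
  have e11 : ∫ p, f p.1 * f p.1 ∂(π ⊗ₘ K) = ∫ z, f z * f z ∂π := by
    conv_rhs => rw [← Measure.fst_compProd π K, Measure.fst]
    exact (integral_map measurable_fst.aemeasurable (hf.mul hf).aestronglyMeasurable).symm
  have e22 : ∫ p, f p.2 * f p.2 ∂(π ⊗ₘ K) = ∫ z, f z * f z ∂π := by
    conv_rhs => rw [← hK.def, ← Measure.snd_compProd π K, Measure.snd]
    exact (integral_map measurable_snd.aemeasurable (hf.mul hf).aestronglyMeasurable).symm
  -- Subharmonicity is multiplied by `f z ≥ 0`. As both marginals of `π ⊗ₘ K` are `π`, the mean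
  -- square increment of `f` is then at most 0.
  have e12 : ∫ z, f z * f z ∂π ≤ ∫ p, f p.1 * f p.2 ∂(π ⊗ₘ K) := by
    rw [Measure.integral_compProd i12]
    refine integral_mono hsq (Integrable.integral_compProd (κ := Kernel.const Unit π)
      (η := Kernel.prodMkLeft Unit K) (a := ()) i12) fun z => ?_
    simp only [integral_const_mul]
    exact mul_le_mul_of_nonneg_left (hsub z) (h0 z)
  have hzero : ∫ p, (f p.2 - f p.1) ^ 2 ∂(π ⊗ₘ K) = 0 := by
    refine le_antisymm ?_ (integral_nonneg fun p => sq_nonneg _)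
    have : ∫ p, (f p.2 - f p.1) ^ 2 ∂(π ⊗ₘ K) = ∫ p, f p.2 * f p.2 ∂(π ⊗ₘ K) +
        ∫ p, f p.1 * f p.1 ∂(π ⊗ₘ K) - 2 * ∫ p, f p.1 * f p.2 ∂(π ⊗ₘ K) := by
      rw [← integral_const_mul, ← integral_add i22 i11]
      refine Eq.trans ?_ (integral_sub (i22.add i11) (i12.const_mul 2))
      congr 1
      funext p
      change _ = f p.2 * f p.2 + f p.1 * f p.1 - 2 * (f p.1 * f p.2)
      ring
    rw [this, e11, e22]
    linarith
  have hint : Integrable (fun p : Z × Z => (f p.2 - f p.1) ^ 2) (π ⊗ₘ K) := by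
    refine ((i22.add i11).sub (i12.const_mul 2)).congr (ae_of_all _ fun p => ?_)
    simp only [Pi.add_apply, Pi.sub_apply]
    ring
  have hae := (integral_eq_zero_iff_of_nonneg (fun p => sq_nonneg _) hint).1 hzero
  refine Measure.ae_ae_of_ae_compProd (p := fun p : Z × Z => f p.2 = f p.1) ?_
  filter_upwards [hae] with p hp
  exact sub_eq_zero.1 (pow_eq_zero_iff (two_ne_zero)|>.1 hp)

end Subharmonic

/-! ### Vanishing of the limiting distance and convergence to μ. -/

section Convergence

variable {E : Type*} [MeasurableSpace E]

lemma invariant_pow {P : Kernel E E} {μ : Measure E} (hμ : P.Invariant μ) (n : ℕ) :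
    (P ^ n).Invariant μ := by
  induction n with
  | zero => exact Measure.id_comp
  | succ n ih => rw [pow_succ']; exact hμ.comp ih

lemma invariant_parallelComp {P : Kernel E E} [IsMarkovKernel P] {μ : Measure E}
    [IsProbabilityMeasure μ] (hμ : P.Invariant μ) : (P ∥ₖ P).Invariant (μ.prod μ) := by
  refine (Measure.prod_eq fun s t hs ht => ?_).symm
  have h : ∀ {s : Set E}, MeasurableSet s → ∫⁻ x, P x s ∂μ = μ s := fun hs => by
    rw [← Measure.bind_apply hs (Kernel.aemeasurable _), hμ.def]
  rw [Measure.bind_apply (hs.prod ht) (Kernel.aemeasurable _)]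
  simp only [Kernel.parallelComp_apply_prod]
  rw [lintegral_prod_mul (P.measurable_coe hs).aemeasurable (P.measurable_coe ht).aemeasurable,
    h hs, h ht]

lemma real_comp_eq_integral {Z : Type*} [MeasurableSpace Z] (κ : Kernel Z E) [IsMarkovKernel κ]
    (Q : Measure Z) {A : Set E} (hA : MeasurableSet A) :
    (κ ∘ₘ Q).real A = ∫ z, (κ z).real A ∂Q := by
  simp only [Measure.real]
  rw [Measure.bind_apply hA κ.aemeasurable, integral_toReal
    (κ.measurable_coe hA).aemeasurable (ae_of_all _ fun z => measure_lt_top _ _)]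

/-- Convexity of total variation. Countable generation makes the integrand measurable. -/
lemma tvDist_comp_le_integral [MeasurableSpace.CountablyGenerated E] {Z : Type*}
    [MeasurableSpace Z] (κ η : Kernel Z E) [IsMarkovKernel κ] [IsMarkovKernel η] (Q : Measure Z)
    [IsFiniteMeasure Q] :
    tvDist (κ ∘ₘ Q) (η ∘ₘ Q) ≤ ∫ z, tvDist (κ z) (η z) ∂Q := by
  refine tvDist_le fun A hA => ?_
  have hi : ∀ (κ : Kernel Z E) [IsMarkovKernel κ], Integrable (fun z => (κ z).real A) Q :=
    fun κ _ => integrable_of_mem_unitInterval (κ.measurable_coe hA).ennreal_toReal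
      (fun _ => measureReal_nonneg) (fun _ => measureReal_le_one) Q
  rw [real_comp_eq_integral κ Q hA, real_comp_eq_integral η Q hA, ← integral_sub (hi κ) (hi η)]
  refine abs_integral_le_integral_abs.trans (integral_mono ((hi κ).sub (hi η)).abs ?_ fun z => ?_)
  · exact integrable_of_mem_unitInterval (measurable_tvDist κ η) (fun _ => tvDist_nonneg _ _)
      (fun _ => tvDist_le_one _ _) Q
  · exact abs_real_sub_real_le_tvDist _ _ hA

/-- Total variation distance of the laws at time `n` of the chains started at a pair of states. -/
noncomputable def stepDist (P : Kernel E E) (n : ℕ) (z : E × E) : ℝ :=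
  tvDist ((P ^ n) z.1) ((P ^ n) z.2)

/-- The limit of `stepDist P n`. -/
noncomputable def limitDist (P : Kernel E E) (z : E × E) : ℝ := ⨅ n, stepDist P n z

lemma pow_add_apply (P : Kernel E E) (m n : ℕ) (x : E) : (P ^ (m + n)) x = (P ^ m : Kernel E E) ∘ₘ (P ^ n) x := by
  rw [Kernel.pow_add, Kernel.comp_apply]

lemma stepDist_nonneg (P : Kernel E E) (n : ℕ) (z : E × E) : 0 ≤ stepDist P n z :=
  tvDist_nonneg _ _

lemma bddBelow_stepDist (P : Kernel E E) (z : E × E) : BddBelow (Set.range fun n => stepDist P n z) :=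
  ⟨0, by rintro _ ⟨n, rfl⟩; exact stepDist_nonneg P n z⟩

lemma limitDist_nonneg (P : Kernel E E) (z : E × E) : 0 ≤ limitDist P z :=
  le_ciInf fun n => stepDist_nonneg P n z

lemma limitDist_self (P : Kernel E E) (x : E) : limitDist P (x, x) = 0 := by
  simp [limitDist, stepDist]

lemma AsympEquiv.eventuallyNonsingular {P : Kernel E E} {x y : E} (h : AsympEquiv P x y) :
    EventuallyNonsingular P x y := by
  obtain ⟨n, hn, A, hA, hx, -, hac, -⟩ := h (1 / 2) (by norm_num)
  refine ⟨n, hn, fun hs => ?_⟩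
  have h0 : ((P ^ n) x).restrict A = 0 := by
    refine Measure.eq_zero_of_absolutelyContinuous_of_mutuallySingular hac ?_
    exact (hs.restrict A).symm.restrict A |>.symm
  have : ((P ^ n) x).real A = 0 := by
    rw [Measure.real, Measure.restrict_eq_zero.1 h0, ENNReal.toReal_zero]
  linarith

variable (P : Kernel E E) [IsMarkovKernel P]

lemma measurable_stepDist [MeasurableSpace.CountablyGenerated E] (n : ℕ) :
    Measurable (stepDist P n) :=
  measurable_tvDist ((P ^ n).comap Prod.fst measurable_fst) ((P ^ n).comap Prod.snd measurable_snd)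

lemma stepDist_le_one (n : ℕ) (z : E × E) : stepDist P n z ≤ 1 := tvDist_le_one _ _

lemma stepDist_antitone (z : E × E) : Antitone fun n => stepDist P n z := by
  refine antitone_nat_of_succ_le fun n => ?_
  simp only [stepDist]
  rw [add_comm n 1, pow_add_apply, pow_add_apply]
  exact tvDist_comp_le _ _ _

lemma tendsto_stepDist (z : E × E) :
    Tendsto (fun n => stepDist P n z) atTop (𝓝 (limitDist P z)) :=
  tendsto_atTop_ciInf (stepDist_antitone P z) (bddBelow_stepDist P z)

lemma limitDist_le_one (z : E × E) : limitDist P z ≤ 1 :=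
  (ciInf_le (bddBelow_stepDist P z) 0).trans (stepDist_le_one P 0 z)

lemma measurable_limitDist [MeasurableSpace.CountablyGenerated E] : Measurable (limitDist P) :=
  Measurable.iInf fun n => measurable_stepDist P n

/-- Arbitrary couplings are allowed because two are needed: the independent one for subharmonicity,
and one charging the diagonal for the contraction. -/
lemma limitDist_le_integral [MeasurableSpace.CountablyGenerated E] {n : ℕ} {z : E × E}
    {Q : Measure (E × E)} [IsFiniteMeasure Q] (hQ : IsCoupling ((P ^ n) z.1) ((P ^ n) z.2) Q) :
    limitDist P z ≤ ∫ w, limitDist P w ∂Q := by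
  have hle : ∀ m, limitDist P z ≤ ∫ w, stepDist P m w ∂Q := fun m => by
    refine (ciInf_le (bddBelow_stepDist P z) (m + n)).trans ?_
    simp only [stepDist]
    rw [pow_add_apply, pow_add_apply, ← hQ.1, ← hQ.2, Measure.fst, Measure.snd,
      ← comap_comp_eq _ measurable_fst, ← comap_comp_eq _ measurable_snd]
    -- Both laws at time `m + n` are now mixtures over the same pair drawn from `Q`.
    exact tvDist_comp_le_integral _ _ Q
  refine ge_of_tendsto' (tendsto_integral_of_dominated_convergence (fun _ => (1 : ℝ))
    (fun m => (measurable_stepDist P m).aestronglyMeasurable) (integrable_const _)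
    (fun m => ae_of_all _ fun w => ?_) (ae_of_all _ fun w => tendsto_stepDist P w)) hle
  rw [Real.norm_of_nonneg (stepDist_nonneg P m w)]
  exact stepDist_le_one P m w

/-- If the limiting distance is constant along independent chains, then it vanishes as soon as
the laws at some time are not mutually singular. -/
lemma limitDist_eq_zero_of_not_mutuallySingular [MeasurableSpace.CountablyGenerated E] {n : ℕ}
    {z : E × E} (hz : ∀ᵐ w ∂(((P ^ n) z.1).prod ((P ^ n) z.2)), limitDist P w = limitDist P z)
    (hn : ¬ (P ^ n) z.1 ⟂ₘ (P ^ n) z.2) : limitDist P z = 0 := by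
  obtain ⟨m, a, b, h₁, h₂, hab⟩ := exists_common_add_mutuallySingular ((P ^ n) z.1) ((P ^ n) z.2)
  have := isFiniteMeasure_left_of_eq_add h₁
  have := isFiniteMeasure_right_of_eq_add h₁
  have := isFiniteMeasure_right_of_eq_add h₂
  have hmass : a Set.univ = b Set.univ := by
    have e₁ : m Set.univ + a Set.univ = 1 := by
      rw [← Measure.add_apply, ← h₁, measure_univ]
    have e₂ : m Set.univ + b Set.univ = 1 := by
      rw [← Measure.add_apply, ← h₂, measure_univ]
    exact (ENNReal.add_right_inj (measure_ne_top m _)).1 (e₁.trans e₂.symm)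
  have hlt : a.real Set.univ < 1 := by
    refine lt_of_le_of_lt ?_ (tvDist_lt_one_of_not_mutuallySingular hn)
    rw [h₁, h₂]
    exact real_univ_le_tvDist hab
  obtain ⟨ζ, hζ, hζac⟩ := exists_isCoupling hmass
  have := hζ.isFiniteMeasure
  have hdiag : Measurable fun x : E => (x, x) := measurable_id.prodMk measurable_id
  have hcd : IsCoupling m m (m.map fun x => (x, x)) :=
    ⟨(Measure.fst_map_prodMk measurable_id).trans Measure.map_id,
      (Measure.snd_map_prodMk measurable_id).trans Measure.map_id⟩
  have hc := hcd.add hζ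
  rw [← h₁, ← h₂] at hc
  -- The off-diagonal part is dominated by the independent law, so the constancy in `hz` applies to
  -- it.
  have hac : a.prod b ≪ ((P ^ n) z.1).prod ((P ^ n) z.2) := by
    refine Measure.AbsolutelyContinuous.prod ?_ ?_
    · rw [h₁]; exact Measure.absolutelyContinuous_of_le (Measure.le_add_left le_rfl)
    · rw [h₂]; exact Measure.absolutelyContinuous_of_le (Measure.le_add_left le_rfl)
  have hint : ∀ Q : Measure (E × E), ∀ [IsFiniteMeasure Q], Integrable (limitDist P) Q :=
    fun Q _ => integrable_of_mem_unitInterval (measurable_limitDist P) (limitDist_nonneg P)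
      (limitDist_le_one P) Q
  have hle := limitDist_le_integral P hc
  rw [integral_add_measure (hint _) (hint _), integral_map hdiag.aemeasurable
    (measurable_limitDist P).aestronglyMeasurable] at hle
  simp only [limitDist_self, integral_zero, zero_add] at hle
  rw [integral_congr_ae (hζac.trans hac |>.ae_le hz), integral_const, smul_eq_mul] at hle
  have hζu : ζ.real Set.univ = a.real Set.univ := by
    rw [← hζ.1, Measure.real, Measure.real, Measure.fst_univ]
  rw [hζu] at hle
  have h0 := limitDist_nonneg P z
  -- The bound reads L ≤ L · a(E) with a(E) < 1 and L ≥ 0.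
  nlinarith

variable {P} {μ : Measure E} [IsProbabilityMeasure μ]

lemma ae_limitDist_eq_zero [MeasurableSpace.CountablyGenerated E] (hμ : P.Invariant μ)
    (hA : AssumptionA3 P μ) : ∀ᵐ z ∂(μ.prod μ), limitDist P z = 0 := by
  have hconst : ∀ᵐ z ∂(μ.prod μ), ∀ n : ℕ,
      ∀ᵐ w ∂(((P ^ n) z.1).prod ((P ^ n) z.2)), limitDist P w = limitDist P z := by
    refine ae_all_iff.2 fun n => ?_
    have := ae_ae_eq_of_le_integral (invariant_parallelComp (invariant_pow hμ n))
      (measurable_limitDist P) (limitDist_nonneg P) (limitDist_le_one P) fun z => by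
        rw [Kernel.parallelComp_apply]
        exact limitDist_le_integral P ⟨Measure.fst_prod, Measure.snd_prod⟩
    simpa only [Kernel.parallelComp_apply] using this
  filter_upwards [hconst, hA] with z hz hs
  obtain ⟨n, -, hn⟩ := hs
  exact limitDist_eq_zero_of_not_mutuallySingular P (hz n) hn

theorem propertyP3_of_assumptionA3 [MeasurableSpace.CountablyGenerated E] (hμ : P.Invariant μ)
    (hA : AssumptionA3 P μ) : PropertyP3 P μ := by
  filter_upwards [Measure.ae_ae_of_ae_prod (ae_limitDist_eq_zero hμ hA)] with x hx
  have hle : ∀ n, tvDist ((P ^ n) x) μ ≤ ∫ y, stepDist P n (x, y) ∂μ := fun n => by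
    -- By invariance, `μ` is the mixture of the laws `(P ^ n) y` over `y` drawn from `μ`.
    have h := tvDist_comp_le_integral (Kernel.const E ((P ^ n) x)) (P ^ n) μ
    rw [(invariant_pow hμ n).def, Measure.const_comp, measure_univ, one_smul] at h
    exact h
  have hlim : Tendsto (fun n => ∫ y, stepDist P n (x, y) ∂μ) atTop (𝓝 (∫ _, (0 : ℝ) ∂μ)) := by
    refine tendsto_integral_of_dominated_convergence (fun _ => (1 : ℝ))
      (fun n => ((measurable_stepDist P n).comp measurable_prodMk_left).aestronglyMeasurable)
      (integrable_const _) (fun n => ae_of_all _ fun y => ?_) ?_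
    · rw [Real.norm_of_nonneg (stepDist_nonneg P n _)]
      exact stepDist_le_one P n _
    · filter_upwards [hx] with y hy
      exact hy ▸ tendsto_stepDist P (x, y)
  rw [integral_zero] at hlim
  exact squeeze_zero (fun n => tvDist_nonneg _ _) hle hlim

/-- Asymptotic equivalence of all states upgrades convergence from almost all initial states to
convergence from every initial state. -/
lemma tendsto_tvDist_of_assumptionA1 [MeasurableSpace.CountablyGenerated E] (hμ : P.Invariant μ)
    (hA : AssumptionA1 P) (x : E) : Tendsto (fun n => tvDist ((P ^ n) x) μ) atTop (𝓝 0) := by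
  have hP : PropertyP3 P μ := propertyP3_of_assumptionA3 hμ
    (ae_of_all _ fun z => (hA z.1 z.2).eventuallyNonsingular)
  -- By invariance, the chain from a typical `y` almost surely avoids the `μ`-null set of bad states
  -- at each time.
  have hgood : ∀ᵐ y ∂μ, ∀ n : ℕ, ∀ᵐ u ∂((P ^ n) y),
      Tendsto (fun m => tvDist ((P ^ m) u) μ) atTop (𝓝 0) := by
    refine ae_all_iff.2 fun n => Measure.ae_ae_of_ae_comp ?_
    rw [(invariant_pow hμ n).def]
    exact hP
  obtain ⟨y, hy⟩ := hgood.exists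
  have hanti : Antitone fun n => tvDist ((P ^ n) x) μ := by
    refine antitone_nat_of_succ_le fun n => ?_
    rw [add_comm n 1, pow_add_apply]
    conv_lhs => rw [← (invariant_pow hμ 1).def]
    exact tvDist_comp_le _ _ _
  refine Metric.tendsto_atTop.2 fun ε hε => ?_
  obtain ⟨n, -, A, hAm, hxA, -, hac, -⟩ := hA x y (ε / 2) (by linarith)
  -- Restart at time `n`: states outside `A` cost at most their mass `ε / 2`; on `A`, absolute
  -- continuity makes almost every state good, as from `y`.
  have hle : ∀ m, tvDist ((P ^ (m + n)) x) μ ≤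
      ε / 2 + ∫ u in A, tvDist ((P ^ m) u) μ ∂((P ^ n) x) := fun m => by
    have hi : Integrable (fun u => tvDist ((P ^ m) u) μ) ((P ^ n) x) :=
      integrable_of_mem_unitInterval (measurable_tvDist (P ^ m) (Kernel.const E μ))
        (fun _ => tvDist_nonneg _ _) (fun _ => tvDist_le_one _ _) _
    have h := tvDist_comp_le_integral (P ^ m) (Kernel.const E μ) ((P ^ n) x)
    rw [Measure.const_comp, measure_univ, one_smul, ← pow_add_apply] at h
    simp only [Kernel.const_apply] at h
    rw [← integral_add_compl hAm hi, add_comm (∫ u in A, _ ∂_)] at h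
    refine h.trans (add_le_add_left ?_ _)
    calc ∫ u in Aᶜ, tvDist ((P ^ m) u) μ ∂((P ^ n) x) ≤ ∫ _ in Aᶜ, (1 : ℝ) ∂((P ^ n) x) :=
          integral_mono hi.integrableOn (integrable_const _) fun u => tvDist_le_one _ _
      _ = ((P ^ n) x).real Aᶜ := by simp
      _ ≤ ε / 2 := by rw [probReal_compl_eq_one_sub hAm]; linarith
  have hlim : Tendsto (fun m => ∫ u in A, tvDist ((P ^ m) u) μ ∂((P ^ n) x)) atTop
      (𝓝 (∫ _ in A, (0 : ℝ) ∂((P ^ n) x))) := by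
    refine tendsto_integral_of_dominated_convergence (fun _ => (1 : ℝ))
      (fun m => (measurable_tvDist (P ^ m) (Kernel.const E μ)).aestronglyMeasurable)
      (integrable_const _) (fun m => ae_of_all _ fun u => ?_) ?_
    · rw [Real.norm_of_nonneg (tvDist_nonneg _ _)]
      exact tvDist_le_one _ _
    · exact hac.ae_le (ae_restrict_of_ae (hy n))
  rw [integral_zero] at hlim
  obtain ⟨m, hm⟩ := (hlim.eventually (gt_mem_nhds (half_pos hε))).exists
  refine ⟨m + n, fun k hk => ?_⟩
  rw [Real.dist_0_eq_abs, abs_of_nonneg (tvDist_nonneg _ _)]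
  have h₁ := hanti hk
  have h₂ := hle m
  simp only at h₁
  linarith

end Convergence

/-! ### From distances to couplings. -/

section Coupling

variable {E : Type u} [MeasurableSpace E] [StandardBorelSpace E] {P : Kernel E E}
  [IsMarkovKernel P]

lemma hasSuccessfulCoupling_of_limitDist_eq_zero {x y : E} (h : limitDist P (x, y) = 0) :
    HasSuccessfulCoupling P x y := by
  obtain ⟨Ω, mΩ, ρ, X, Y, hc, hle⟩ := exists_isChainCoupling P x y
  refine ⟨Ω, mΩ, ρ, X, Y, hc, ?_⟩
  have := hc.1
  have hlim := ENNReal.Tendsto.sub (tendsto_const_nhds (x := (1 : ENNReal)))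
    (ENNReal.tendsto_ofReal (tendsto_stepDist P (x, y))) (Or.inl ENNReal.one_ne_top)
  rw [h, ENNReal.ofReal_zero, tsub_zero] at hlim
  exact tendsto_of_tendsto_of_tendsto_of_le_of_le hlim tendsto_const_nhds hle
    fun n => prob_le_one

lemma hasPartialCoupling_of_eventuallyNonsingular {x y : E} (h : EventuallyNonsingular P x y) :
    HasPartialCoupling P x y := by
  obtain ⟨Ω, mΩ, ρ, X, Y, hc, hle⟩ := exists_isChainCoupling P x y
  refine ⟨Ω, mΩ, ρ, X, Y, hc, ?_⟩
  obtain ⟨n, -, hn⟩ := h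
  have hpos : 0 < 1 - ENNReal.ofReal (tvDist ((P ^ n) x) ((P ^ n) y)) := by
    rw [tsub_pos_iff_lt, ENNReal.ofReal_lt_one]
    exact tvDist_lt_one_of_not_mutuallySingular hn
  -- The events of agreement from `m` on increase with `m`, so the bound at the single time `n`
  -- persists.
  refine hpos.trans_le ((hle n).trans (le_liminf_of_le (by isBoundedDefault) ?_))
  filter_upwards [eventually_ge_atTop n] with m hm
  exact measure_mono fun ω hω k hk => hω k (hm.trans hk)

end Coupling

end TVConvergence

theorem proposition3p4 {E : Type u} [MeasurableSpace E] [MeasurableSpace.CountablyGenerated E]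
    [MeasurableEq E] (P : Kernel E E) [IsMarkovKernel P]
    (μ : Measure E) [IsProbabilityMeasure μ] (hμ : Kernel.Invariant P μ) :
    (TVConvergence.AssumptionA3 P μ → TVConvergence.PropertyP3 P μ) ∧
    (StandardBorelSpace E →
      (TVConvergence.AssumptionA1 P → TVConvergence.AssumptionC1' P) ∧
      (TVConvergence.AssumptionA2 P → TVConvergence.AssumptionC2' P μ) ∧
      (TVConvergence.AssumptionA3 P μ → TVConvergence.AssumptionC3' P μ)) := by
  refine ⟨TVConvergence.propertyP3_of_assumptionA3 hμ, fun _ => ?_⟩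
  have hC3 : TVConvergence.AssumptionA3 P μ → TVConvergence.AssumptionC3' P μ := fun hA =>
    (TVConvergence.ae_limitDist_eq_zero hμ hA).mono fun z hz =>
      TVConvergence.hasSuccessfulCoupling_of_limitDist_eq_zero hz
  refine ⟨fun hA x y => ?_, fun hA => ⟨fun x y => ?_, hC3 (ae_of_all _ fun z => hA z.1 z.2)⟩, hC3⟩
  -- Both chains converge to `μ`, so the triangle inequality through `μ` makes the limiting distance
  -- vanish for every pair.
  · refine TVConvergence.hasSuccessfulCoupling_of_limitDist_eq_zero
      (tendsto_nhds_unique (TVConvergence.tendsto_stepDist P (x, y)) ?_)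
    have h := (TVConvergence.tendsto_tvDist_of_assumptionA1 hμ hA x).add
      (TVConvergence.tendsto_tvDist_of_assumptionA1 hμ hA y)
    rw [add_zero] at h
    refine squeeze_zero (fun n => TVConvergence.stepDist_nonneg P n _) (fun n => ?_) h
    rw [TVConvergence.tvDist_comm ((P ^ n) y) μ]
    exact TVConvergence.tvDist_triangle _ _ _
  · exact TVConvergence.hasPartialCoupling_of_eventuallyNonsingular (hA x y)
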